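/- For nonzero complex polynomials $P(x)$ and $Q(y)$ without a common zero, let $x_1,\dots,x_p$ be the zeros of $P$ and $y_1,\dots,y_q$ the zeros of $Q$, listed with multiplicity, and let $$\mathrm{PER}(P(x),Q(y)):=\mathrm{per}\left(\frac1{x_i-y_j}\right)_{1\le i\le p,\ 1\le j\le q},$$ where the permanent of a $p\times q$ matrix is the sum of all products of $p$ of its entries, no two of them taken from the same row or from the same column (so it is $0$ if $p>q$). Write $(\alpha)_k:=\alpha(\alpha+1)\cdots(\alpha+k-1)$ for $k\ge1$ and $(\alpha)_0:=1$. Let $n$ and $m$ be positive integers, $n\ge2$, and let $a$ be a complex number such that the polynomials $x^{n-1}+\cdots+x+1$ and $\sum_{\ell=0}^{mn-2}(\ell+a)x^\ell$ have no common zero. Then $(mn+a-1)^n-(a-1)^n\ne0$ and $$\mathrm{PER}\left(x^{n-1}+\cdots+x+1,\ \sum_{\ell=0}^{mn-2}(\ell+a)y^\ell\right)=(-1)^{n-1}\,\frac{nm\,(nm-n)_{n-1}\,(nm+a-1)^{n-1}}{(mn+a-1)^n-(a-1)^n}.$$ -/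

import Mathlib

open Polynomial

/-- The permanent of a rectangular matrix: the sum, over all ways of choosing one entry from each
row with no two of the chosen entries in the same column, of the product of the chosen entries.
(It is `0` if there are more rows than columns.) -/
noncomputable def rectPermanent {α β R : Type*} [Fintype α] [Fintype β] [CommSemiring R]
    (A : Matrix α β R) : R :=
  ∑ σ : α ↪ β, ∏ i : α, A i (σ i)

/-- The Scott-type permanent `PER(P(x), Q(y))` of two complex polynomials: the permanent of the
matrix with entries `1 / (x_i - y_j)`, where the rows are indexed by the zeros `x_i` of `P` and the
columns by the zeros `y_j` of `Q`, both listed with multiplicity. -/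
noncomputable def scottPermanent (P Q : ℂ[X]) : ℂ :=
  rectPermanent (Matrix.of fun (i : P.roots) (j : Q.roots) => 1 / ((i : ℂ) - (j : ℂ)))

/-! For distinct x_i the permanent of (1/(x_i - y_j)) equals the determinant of the square
`borchardtMatrix` (`rectPermanent_cauchy`, a rectangular Borchardt identity). There the y_j enter
only through ∑_j 1/(x_i - y_j) = Q'(x_i)/Q(x_i), so the zeros of Q need not be known.

Put b = mn + a - 1 and c = a - 1. At a nontrivial n-th root of unity x one has x(x - 1)Q(x) = b -
cx, and Q'(x) is equally explicit. Let B be the resulting matrix and s_j the vector of values x_i +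
... + x_i^j. Sums over roots of unity give x(b - cx) Bᵀs_{j+1} = b(b - c - 2 - j) s_{j+1} + jc
s_{j+2} - jc s_1, with s_n = 0. In the basis s_1, ..., s_{n-1} this operator has determinant ∏ b(b -
c - 2 - j) over 0 ≤ j ≤ n - 2 (`det_borchardtMatrix_nthRoots`), which is b^{n-1} (mn - n)_{n-1}
because b - c = mn. Dividing by ∏ x_i(b - c x_i) = (-1)^{n-1} (b^n - c^n)/(mn) gives the formula; no
factor b - c x_i vanishes, since Q(x_i) ≠ 0. -/

/-! ### Permanents of rectangular Cauchy matrices as determinants. -/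

/-- Choosing the entry in the first row first: an injection of `Fin (p + 1)` amounts to the value
at `0` and an injection of `Fin p` avoiding this value. -/
def embeddingFinSuccEquivSigma (p : ℕ) (β : Type*) :
    (Fin (p + 1) ↪ β) ≃ Σ j : β, (Fin p ↪ {b : β // b ≠ j}) where
  toFun σ := ⟨σ 0, ⟨fun i => ⟨σ i.succ, fun h => Fin.succ_ne_zero i (σ.injective h)⟩,
    fun i k h => Fin.succ_injective _ (σ.injective (congrArg Subtype.val h))⟩⟩
  invFun τ := ⟨Fin.cons τ.1 fun i => (τ.2 i : β), Fin.cons_injective_iff.2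
    ⟨by rintro ⟨i, hi⟩; exact (τ.2 i).2 hi, fun i k h => τ.2.injective (Subtype.ext h)⟩⟩
  left_inv σ := by
    ext i
    refine Fin.cases ?_ (fun i => ?_) i <;> rfl
  right_inv τ := rfl

theorem rectPermanent_succ {p : ℕ} {β R : Type*} [Fintype β] [DecidableEq β] [CommSemiring R]
    (A : Matrix (Fin (p + 1)) β R) :
    rectPermanent A = ∑ j : β, A 0 j *
      rectPermanent (Matrix.of fun (i : Fin p) (b : {b : β // b ≠ j}) => A i.succ b) := by
  classical
  unfold rectPermanent
  rw [← (embeddingFinSuccEquivSigma p β).symm.sum_comp, Fintype.sum_sigma]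
  refine Finset.sum_congr rfl fun j _ => ?_
  rw [Finset.mul_sum]
  refine Finset.sum_congr (by congr!) fun τ _ => ?_
  rw [Fin.prod_univ_succ]
  rfl

theorem rectPermanent_reindex {α α' β R : Type*} [Fintype α] [Fintype α'] [Fintype β]
    [CommSemiring R] (e : α' ≃ α) (A : Matrix α β R) :
    rectPermanent (Matrix.of fun i j => A (e i) j) = rectPermanent A := by
  classical
  unfold rectPermanent
  rw [← (Equiv.embeddingCongr e (Equiv.refl β)).sum_comp]
  refine Finset.sum_congr (by congr!) fun σ _ => ?_
  rw [← e.prod_comp]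
  simp

/-- The matrix with off-diagonal entries `1 / (x i - x k)` and diagonal entries
`∑ j, 1 / (x i - y j) - ∑ k ≠ i, 1 / (x i - x k)`. Note that `1 / (x i - x i) = 0`. -/
noncomputable def borchardtMatrix {α β K : Type*} [Fintype α] [DecidableEq α] [Fintype β] [Field K]
    (x : α → K) (y : β → K) : Matrix α α K :=
  Matrix.of (fun i k => 1 / (x i - x k)) +
    Matrix.diagonal fun i => ∑ j, 1 / (x i - y j) - ∑ k, 1 / (x i - x k)

theorem det_updateCol_finset_sum {n ι R : Type*} [Fintype n] [DecidableEq n] [CommRing R]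
    (M : Matrix n n R) (k : n) (s : Finset ι) (u : ι → n → R) :
    (M.updateCol k (fun i => ∑ j ∈ s, u j i)).det = ∑ j ∈ s, (M.updateCol k (u j)).det := by
  classical
  induction s using Finset.induction_on with
  | empty => simpa using Matrix.det_eq_zero_of_column_eq_zero k (by simp)
  | insert a s ha ih =>
    rw [Finset.sum_insert ha, ← ih, ← Matrix.det_updateCol_add]
    congr 2
    ext i
    simp [Finset.sum_insert ha]

/-- Clearing column 0 below its top entry by row operations leaves a minor that is a diagonal
conjugate of the matrix with x_0 and y_j removed. -/
theorem det_borchardtMatrix_updateCol {p : ℕ} {β K : Type*} [Fintype β] [DecidableEq β] [Field K]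
    (x : Fin (p + 1) → K) (hx : Function.Injective x) (y : β → K) (hxy : ∀ i j, x i ≠ y j)
    (j : β) :
    ((borchardtMatrix x y).updateCol 0 fun i => 1 / (x i - y j)).det =
      1 / (x 0 - y j) *
        (borchardtMatrix (fun i : Fin p => x i.succ) fun b : {b : β // b ≠ j} => y b).det := by
  have hne : ∀ i, x i - y j ≠ 0 := fun i => sub_ne_zero.2 (hxy i j)
  have h0 : ∀ i : Fin p, x 0 - x i.succ ≠ 0 := fun i =>
    sub_ne_zero.2 fun h => Fin.succ_ne_zero i (hx h).symm
  set M := (borchardtMatrix x y).updateCol 0 fun i => 1 / (x i - y j) with hM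
  set c : Fin (p + 1) → K := Fin.cons 0 fun i => - ((x 0 - y j) / (x i.succ - y j)) with hc
  have hrow : M.det = (Matrix.of fun i k => M i k + c i * M 0 k).det := by
    refine (Matrix.det_eq_of_forall_row_eq_smul_add_const c 0 (by simp [hc]) ?_).symm
    intro i k
    rfl
  rw [hrow, Matrix.det_succ_column_zero, Fin.sum_univ_succ, Finset.sum_eq_zero, add_zero]
  · have h00 : M 0 0 = 1 / (x 0 - y j) := by simp [hM]
    simp only [Fin.val_zero, pow_zero, one_mul, Matrix.of_apply, h00]
    congr 1
    · simp [hc]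
    -- The conjugating diagonal: off the diagonal, 1/(x_i - x_k) - (x_0 - y_j)/((x_i - y_j)(x_0 -
    -- x_k)) = d_i d_k⁻¹/(x_i - x_k).
    set d : Fin p → K := fun i => (x 0 - x i.succ) / (x i.succ - y j) with hd
    have hd0 : ∀ i, d i ≠ 0 := fun i => div_ne_zero (h0 i) (hne _)
    set B := borchardtMatrix (fun i : Fin p => x i.succ) fun b : {b : β // b ≠ j} => y b with hB
    have key : (Matrix.of fun i k => M i k + c i * M 0 k).submatrix (Fin.succAbove 0) Fin.succ =
        Matrix.of fun i k => (d k)⁻¹ * (Matrix.of fun i k => d i * B i k) i k := by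
      ext i k
      have hL : ∑ b, 1 / (x i.succ - y b) =
          1 / (x i.succ - y j) + ∑ b : {b : β // b ≠ j}, 1 / (x i.succ - y b) := by
        rw [← Finset.sum_subtype (Finset.univ.erase j) (by simp)
          (fun b => 1 / (x i.succ - y b)),
          Finset.add_sum_erase _ (fun b => 1 / (x i.succ - y b)) (Finset.mem_univ j)]
      by_cases hik : i = k
      · subst hik
        have hdi : (d i)⁻¹ * (d i * B i i) = B i i := by rw [inv_mul_cancel_left₀ (hd0 i)]
        simp only [Matrix.submatrix_apply, Matrix.of_apply, hdi, Fin.succAbove_zero]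
        simp only [hM, hB, borchardtMatrix, hc, Fin.cons_succ, Matrix.add_apply, Matrix.of_apply,
          Matrix.diagonal_apply_eq, Matrix.updateCol_apply, Fin.succ_ne_zero, if_false, sub_self,
          div_zero, zero_add, hL, Fin.sum_univ_succ,
          Matrix.diagonal_apply_ne _ (Fin.succ_ne_zero i).symm]
        have := hne i.succ
        have := hne 0
        have h1 := h0 i
        have h2 : x i.succ - x 0 = -(x 0 - x i.succ) := by ring
        rw [h2]
        field_simp
        ring
      · have hik' : i.succ ≠ k.succ := fun h => hik (Fin.succ_injective _ h)
        have h3 : x i.succ - x k.succ ≠ 0 := sub_ne_zero.2 fun h => hik' (hx h)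
        simp only [Matrix.submatrix_apply, Matrix.of_apply, Fin.succAbove_zero]
        simp only [hM, hB, hd, borchardtMatrix, hc, Fin.cons_succ, Matrix.add_apply,
          Matrix.of_apply, Matrix.updateCol_apply, Fin.succ_ne_zero, if_false,
          Matrix.diagonal_apply_ne _ (Fin.succ_ne_zero k).symm, Matrix.diagonal_apply_ne _ hik,
          Matrix.diagonal_apply_ne _ hik', add_zero]
        have := hne i.succ
        have := hne k.succ
        have := hne 0
        have h1 := h0 i
        have h2 := h0 k
        field_simp
        ring
    rw [key, Matrix.det_mul_row, Matrix.det_mul_column, ← mul_assoc, ← Finset.prod_mul_distrib]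
    simp [hd0]
  · intro i _
    have : M i.succ 0 + c i.succ * M 0 0 = 0 := by
      have := hne i.succ
      have := hne 0
      simp only [hM, hc, Fin.cons_succ, Matrix.updateCol_self]
      field_simp
      ring
    simp [this]

/-- The permanent of a rectangular Cauchy matrix as a determinant. -/
theorem rectPermanent_cauchy {K : Type*} [Field K] (p : ℕ) {β : Type*} [Fintype β]
    [DecidableEq β] (x : Fin p → K) (hx : Function.Injective x) (y : β → K)
    (hxy : ∀ i j, x i ≠ y j) :
    rectPermanent (Matrix.of fun i j => 1 / (x i - y j)) = (borchardtMatrix x y).det := by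
  induction p generalizing β with
  | zero => simp [rectPermanent]
  | succ p ih =>
    -- Adding all other columns to column 0 turns it into the row sums ∑_j 1/(x_i - y_j); linearity
    -- in j then matches the expansion of the permanent along its first row.
    have hcol : (borchardtMatrix x y).det =
        ((borchardtMatrix x y).updateCol 0 fun i => ∑ j, 1 / (x i - y j)).det := by
      have := Matrix.det_updateCol_sum (borchardtMatrix x y) 0 (fun _ => 1)
      rw [one_smul] at this
      rw [← this]
      congr 2
      ext i
      simp [borchardtMatrix, Finset.sum_add_distrib, Matrix.diagonal_apply]
    rw [rectPermanent_succ, hcol, det_updateCol_finset_sum]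
    refine Finset.sum_congr rfl fun j _ => ?_
    rw [det_borchardtMatrix_updateCol x hx y hxy j, ← ih (fun i => x i.succ)
      (hx.comp (Fin.succ_injective p)) (fun b : {b : β // b ≠ j} => y b) (fun i b => hxy _ _)]
    rfl

/-! ### Sums over roots of unity. -/

theorem sum_pow_nthRootsFinset_one {n r : ℕ} (hr : 0 < r) (hrn : r < n) :
    ∑ z ∈ nthRootsFinset n (1 : ℂ), z ^ r = 0 := by
  have hn : 0 < n := hr.trans hrn
  have hζ := Complex.isPrimitiveRoot_exp n hn.ne'
  set ζ := Complex.exp (2 * Real.pi * Complex.I / n)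
  have hmem : ∀ z, z ∈ nthRootsFinset n (1 : ℂ) ↔ z ^ n = 1 := fun z => mem_nthRootsFinset hn 1
  have hζ0 : ζ ≠ 0 := hζ.ne_zero hn.ne'
  have h : ∑ z ∈ nthRootsFinset n (1 : ℂ), z ^ r =
      ζ ^ r * ∑ z ∈ nthRootsFinset n (1 : ℂ), z ^ r := by
    rw [Finset.mul_sum]
    refine Finset.sum_nbij' (fun z => ζ⁻¹ * z) (fun z => ζ * z) ?_ ?_ ?_ ?_ ?_
    · intro z hz
      rw [hmem] at hz ⊢
      simp [mul_pow, hz, hζ.pow_eq_one]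
    · intro z hz
      rw [hmem] at hz ⊢
      simp [mul_pow, hz, hζ.pow_eq_one]
    · intro z _
      simp [hζ0]
    · intro z _
      simp [hζ0]
    · intro z _
      rw [mul_pow, ← mul_assoc, ← mul_pow, mul_inv_cancel₀ hζ0, one_pow, one_mul]
  have h1 : (1 - ζ ^ r) * ∑ z ∈ nthRootsFinset n (1 : ℂ), z ^ r = 0 := by
    linear_combination h
  refine (mul_eq_zero.1 h1).resolve_left (sub_ne_zero.2 fun h2 => ?_)
  exact hζ.pow_ne_one_of_pos_of_lt hr.ne' hrn h2.symm

/-- The involution z ↦ w²/z of the roots of unity changes the sign of each summand; the term z = w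
is 0 by the convention for division by zero. -/
theorem sum_add_div_sub_nthRootsFinset_one {n : ℕ} (hn : 0 < n) {w : ℂ} (hw : w ^ n = 1) :
    ∑ z ∈ nthRootsFinset n (1 : ℂ), (z + w) / (z - w) = 0 := by
  have hmem : ∀ z, z ∈ nthRootsFinset n (1 : ℂ) ↔ z ^ n = 1 := fun z => mem_nthRootsFinset hn 1
  have h0 : ∀ z : ℂ, z ^ n = 1 → z ≠ 0 := by
    rintro z hz rfl
    simp [hn.ne'] at hz
  have hw0 := h0 w hw
  have h : ∑ z ∈ nthRootsFinset n (1 : ℂ), (z + w) / (z - w) =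
      ∑ z ∈ nthRootsFinset n (1 : ℂ), -((z + w) / (z - w)) := by
    have hmaps : ∀ z ∈ nthRootsFinset n (1 : ℂ), w ^ 2 / z ∈ nthRootsFinset n (1 : ℂ) := by
      intro z hz
      rw [hmem] at hz ⊢
      rw [div_pow, hz, ← pow_mul, mul_comm, pow_mul, hw]
      simp
    have hinv : ∀ z ∈ nthRootsFinset n (1 : ℂ), w ^ 2 / (w ^ 2 / z) = z := by
      intro z hz
      have := h0 z ((hmem z).1 hz)
      field_simp
    refine Finset.sum_nbij' (fun z => w ^ 2 / z) (fun z => w ^ 2 / z) hmaps hmaps hinv hinv ?_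
    intro z hz
    have hz0 := h0 z ((hmem z).1 hz)
    rcases eq_or_ne z w with rfl | hzw
    · simp [pow_two, hz0]
    · have h1 : w ^ 2 / z + w = w / z * (z + w) := by field_simp; ring
      have h2 : w ^ 2 / z - w = w / z * -(z - w) := by field_simp; ring
      rw [h1, h2, mul_div_mul_left _ _ (div_ne_zero hw0 hz0), div_neg, neg_neg]
  rw [Finset.sum_neg_distrib] at h
  linear_combination h / 2

theorem sum_pow_add_pow_div_sub_nthRootsFinset_one {n : ℕ} (hn : 0 < n) {w : ℂ} (hw : w ^ n = 1)
    {j : ℕ} (hj : j < n) :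
    ∑ z ∈ nthRootsFinset n (1 : ℂ), (z ^ (j + 1) + w ^ (j + 1)) / (z - w) = -(j * w ^ j) := by
  induction j with
  | zero => simpa using sum_add_div_sub_nthRootsFinset_one hn hw
  | succ j ih =>
    have hwm : w ∈ nthRootsFinset n (1 : ℂ) := (mem_nthRootsFinset hn 1).2 hw
    -- The `if` cancels z^(j+1) at z = w, where both quotients are 0 by convention.
    have h : ∀ z : ℂ, (z ^ (j + 1 + 1) + w ^ (j + 1 + 1)) / (z - w) =
        w * ((z ^ (j + 1) + w ^ (j + 1)) / (z - w)) +
          (z ^ (j + 1) - if z = w then w ^ (j + 1) else 0) := by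
      intro z
      rcases eq_or_ne z w with rfl | hzw
      · simp
      · have := sub_ne_zero.2 hzw
        simp only [hzw, if_false]
        field_simp
        ring
    simp_rw [h]
    rw [Finset.sum_add_distrib, Finset.sum_sub_distrib, ← Finset.mul_sum, ih (by omega),
      sum_pow_nthRootsFinset_one (by omega) hj, Finset.sum_ite_eq' , if_pos hwm]
    push_cast
    ring

/-! ### The determinant at the nontrivial roots of unity. -/

theorem borchardtMatrix_transpose_mulVec {α β K : Type*} [Fintype α] [DecidableEq α] [Fintype β]
    [Field K] (x : α → K) (y : β → K) (v : α → K) (i : α) :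
    ((borchardtMatrix x y).transpose.mulVec v) i =
      (∑ j, 1 / (x i - y j)) * v i + ∑ k, (v k + v i) / (x k - x i) := by
  simp only [borchardtMatrix, Matrix.mulVec, dotProduct, Matrix.transpose_apply, Matrix.add_apply,
    Matrix.of_apply, add_mul, Finset.sum_add_distrib, Matrix.diagonal_apply, ite_mul, zero_mul,
    Finset.sum_ite_eq', Finset.mem_univ, if_true, add_div, sub_mul]
  have h : ∑ k, v i / (x k - x i) = -((∑ k, 1 / (x i - x k)) * v i) := by
    rw [Finset.sum_mul, ← Finset.sum_neg_distrib]
    refine Finset.sum_congr rfl fun k _ => ?_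
    rw [← neg_sub (x i) (x k), div_neg]
    ring
  have h' : ∑ k, 1 / (x k - x i) * v k = ∑ k, v k / (x k - x i) :=
    Finset.sum_congr rfl fun k _ => by ring
  rw [h, h']
  ring

/-- Differences of consecutive columns reduce the matrix to a Vandermonde matrix with row i scaled
by x_i. -/
theorem det_powerSumMatrix_ne_zero {K : Type*} [Field K] {q : ℕ} (x : Fin (q + 1) → K)
    (hx : Function.Injective x) (hx0 : ∀ i, x i ≠ 0) :
    (Matrix.of fun i j : Fin (q + 1) => ∑ r ∈ Finset.range (j + 1), x i ^ (r + 1)).det ≠ 0 := by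
  rw [Matrix.det_eq_of_forall_col_eq_smul_add_pred
    (B := Matrix.of fun i j => x i * Matrix.vandermonde x i j) (c := fun _ => 1)]
  · rw [Matrix.det_mul_column]
    exact mul_ne_zero (Finset.prod_ne_zero_iff.2 fun i _ => hx0 i)
      (Matrix.det_vandermonde_ne_zero_iff.2 hx)
  · simp
  · intro i j
    simp only [Matrix.of_apply, Fin.val_succ, Fin.val_castSucc, Matrix.vandermonde_apply]
    rw [Finset.sum_range_succ]
    ring

/-- The factor j kills the off-diagonal entries of column 0, so expanding along it discards the full
first row and leaves a lower triangular minor. -/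
theorem det_borderedBidiagonal {R : Type*} [CommRing R] (q : ℕ) (d b c : R) :
    (Matrix.of fun r j : Fin (q + 1) => (if r = j then -d + j * b else 0) -
      (if (r : ℕ) = j + 1 then j * c else 0) + if r = 0 then j * c else 0).det =
      ∏ j ∈ Finset.range (q + 1), (-d + j * b) := by
  rw [Matrix.det_succ_column_zero, Fin.sum_univ_succ, Finset.sum_eq_zero, add_zero,
    Matrix.det_of_isLowerTriangular, Finset.prod_range_succ', Finset.prod_range]
  · simp [Fin.succ_ne_zero, mul_comm]
  · intro i j hij
    have h1 : i < j := hij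
    have h3 : ¬ (i : ℕ) = j + 1 := by have : (i : ℕ) < j := h1; omega
    simp [Fin.succ_ne_zero, h1.ne, h3]
  · intro i _
    simp [Fin.succ_ne_zero]

/-- The determinant of `borchardtMatrix x y` when `x` lists the nontrivial `(q + 2)`-th roots of
unity and the logarithmic derivative `∑ j, 1 / (X - y j)` is a suitable rational function there. -/
theorem det_borchardtMatrix_nthRoots {q : ℕ} {β : Type*} [Fintype β] (x : Fin (q + 1) → ℂ)
    (hx : Function.Injective x)
    (hsum : ∀ G : ℂ → ℂ, ∑ i, G (x i) + G 1 = ∑ z ∈ nthRootsFinset (q + 2) (1 : ℂ), G z)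
    (hpow : ∀ i, x i ^ (q + 2) = 1) (hx1 : ∀ i, x i ≠ 1) (y : β → ℂ) (b c : ℂ)
    (hbc : ∀ i, b - c * x i ≠ 0)
    (hL : ∀ i, (∑ j, 1 / (x i - y j)) * (x i * (b - c * x i) * (x i - 1)) =
      c * x i ^ 2 + ((b - c - 2) * b - (b - c)) * x i - (b - c - 1) * b) :
    (borchardtMatrix x y).det * ∏ i, (x i * (b - c * x i)) =
      b ^ (q + 1) * ∏ j ∈ Finset.range (q + 1), (b - c - 2 - j) := by
  have hx0 : ∀ i, x i ≠ 0 := by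
    intro i h
    have := hpow i
    simp [h] at this
  set S : Matrix (Fin (q + 1)) (Fin (q + 1)) ℂ :=
    Matrix.of fun i j => ∑ r ∈ Finset.range (j + 1), x i ^ (r + 1) with hS
  set T : Matrix (Fin (q + 1)) (Fin (q + 1)) ℂ :=
    Matrix.of fun r j => (if r = j then -(b * (b - c - 2)) + j * b else 0) -
      (if (r : ℕ) = j + 1 then j * c else 0) + if r = 0 then j * c else 0 with hT
  have hgeom : ∀ (z : ℂ) (j : ℕ),
      (z - 1) * ∑ r ∈ Finset.range j, z ^ (r + 1) = -(z * (1 - z ^ j)) := by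
    intro z j
    have := mul_geom_sum z j
    simp_rw [pow_succ]
    rw [← Finset.sum_mul]
    linear_combination z * this
  -- The action of the transpose on s_j, with denominators cleared. The root-of-unity sums include z
  -- = 1, whose term is subtracted in `h3`. The right side is again divisible by x_i - 1, which is
  -- why the s_j serve better than monomials.
  have hact : ∀ (i : Fin (q + 1)) (j : ℕ), j ≤ q + 2 →
      x i * (b - c * x i) * (x i - 1) *
        ((∑ l, 1 / (x i - y l)) * ∑ r ∈ Finset.range j, x i ^ (r + 1) +
        ∑ k, (∑ r ∈ Finset.range j, x k ^ (r + 1) + ∑ r ∈ Finset.range j, x i ^ (r + 1)) /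
          (x k - x i)) =
      x i * (-(b * (b - c - 2)) * (1 - x i ^ j) -
        (j - 1) * (c * (x i - x i ^ (j + 1)) - b * (1 - x i ^ j))) := by
    intro i j
    induction j with
    | zero => intro _; simp
    | succ j ih =>
      intro hj
      have h1 := sum_pow_add_pow_div_sub_nthRootsFinset_one (by omega) (hpow i)
        (show j < q + 2 by omega)
      rw [← hsum] at h1
      have h2 : 1 - x i ≠ 0 := sub_ne_zero.2 (hx1 i).symm
      have h3 : (∑ k, (x k ^ (j + 1) + x i ^ (j + 1)) / (x k - x i)) * (1 - x i) =
          -(j * x i ^ j) * (1 - x i) - (1 + x i ^ (j + 1)) := by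
        rw [← h1]
        field_simp
        ring
      have h4 : ∀ k, (∑ r ∈ Finset.range (j + 1), x k ^ (r + 1) +
          ∑ r ∈ Finset.range (j + 1), x i ^ (r + 1)) / (x k - x i) =
          (∑ r ∈ Finset.range j, x k ^ (r + 1) + ∑ r ∈ Finset.range j, x i ^ (r + 1)) /
            (x k - x i) + (x k ^ (j + 1) + x i ^ (j + 1)) / (x k - x i) := by
        intro k
        rw [Finset.sum_range_succ, Finset.sum_range_succ]
        ring
      simp_rw [h4]
      rw [Finset.sum_add_distrib, Finset.sum_range_succ]
      push_cast
      linear_combination ih (by omega) + x i ^ (j + 1) * hL i - x i * (b - c * x i) * h3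
  have hmul : (borchardtMatrix x y).transpose * S =
      Matrix.of fun i j => (-(1 / (x i * (b - c * x i)))) * (S * T) i j := by
    ext i j
    have h1 : ((borchardtMatrix x y).transpose * S) i j =
        (borchardtMatrix x y).transpose.mulVec (fun k => S k j) i := rfl
    have h2 : x i - 1 ≠ 0 := sub_ne_zero.2 (hx1 i)
    have h3 := hact i (j + 1) (by omega)
    have h4 : (x i - 1) * (S * T) i j = -x i * ((-(b * (b - c - 2)) + j * b) * (1 - x i ^ (j + 1 : ℕ))
        - j * c * (1 - x i ^ (j + 2 : ℕ)) + j * c * (1 - x i)) := by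
      have hterm : ∀ r : Fin (q + 1), (x i - 1) * (S i r * T r j) =
          (if r = j then -(x i * (1 - x i ^ (r + 1 : ℕ))) * (-(b * (b - c - 2)) + j * b) else 0) -
          (if (r : ℕ) = j + 1 then -(x i * (1 - x i ^ (r + 1 : ℕ))) * (j * c) else 0) +
          (if r = 0 then -(x i * (1 - x i ^ (r + 1 : ℕ))) * (j * c) else 0) := by
        intro r
        rw [← mul_assoc, hS, Matrix.of_apply, hgeom, hT, Matrix.of_apply, mul_add, mul_sub]
        simp only [mul_ite, mul_zero]
      have hmid : ∑ r : Fin (q + 1),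
          (if (r : ℕ) = j + 1 then -(x i * (1 - x i ^ (r + 1 : ℕ))) * (j * c) else 0) =
          -(x i * (1 - x i ^ (j + 2 : ℕ))) * (j * c) := by
        by_cases hj : (j : ℕ) + 1 < q + 1
        · rw [Finset.sum_eq_single ⟨j + 1, hj⟩]
          · simp
          · intro r _ hr
            rw [if_neg fun h => hr (Fin.ext h)]
          · simp
        -- In the last column T has no row j + 1; nothing is lost, because s_{q+2} vanishes at every
        -- x_i.
        · have hjq : (j : ℕ) + 2 = q + 2 := by omega
          rw [hjq, hpow, Finset.sum_eq_zero]
          · simp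
          · intro r _
            rw [if_neg (by omega)]
      rw [Matrix.mul_apply, Finset.mul_sum, Finset.sum_congr rfl fun r _ => hterm r,
        Finset.sum_add_distrib, Finset.sum_sub_distrib, hmid, Finset.sum_ite_eq',
        Finset.sum_ite_eq']
      simp
      ring
    rw [h1, borchardtMatrix_transpose_mulVec, Matrix.of_apply]
    have h5 : x i * (b - c * x i) * (x i - 1) ≠ 0 :=
      mul_ne_zero (mul_ne_zero (hx0 i) (hbc i)) h2
    apply mul_left_cancel₀ h5
    have h6 : x i * (b - c * x i) * (x i - 1) * (-(1 / (x i * (b - c * x i))) * (S * T) i j) =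
        -((x i - 1) * (S * T) i j) := by
      have h7 := mul_ne_zero (hx0 i) (hbc i)
      generalize x i * (b - c * x i) = u at h7 ⊢
      field_simp
    rw [h6, h4]
    simp only [hS, Matrix.of_apply]
    push_cast at h3
    linear_combination h3
  have hdet := congrArg Matrix.det hmul
  rw [Matrix.det_mul, Matrix.det_transpose, Matrix.det_mul_column, Matrix.det_mul,
    mul_left_comm, mul_comm] at hdet
  have hdet' := mul_left_cancel₀ (det_powerSumMatrix_ne_zero x hx hx0) hdet
  rw [hdet', hT, det_borderedBidiagonal, mul_comm, ← mul_assoc, ← Finset.prod_mul_distrib]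
  have h7 : ∀ i, x i * (b - c * x i) * -(1 / (x i * (b - c * x i))) = -1 := by
    intro i
    rw [mul_neg, mul_one_div_cancel (mul_ne_zero (hx0 i) (hbc i))]
  have h8 : ∀ j : ℕ, -(b * (b - c - 2)) + j * b = -b * (b - c - 2 - j) := fun j => by ring
  simp_rw [h7, h8]
  rw [Finset.prod_mul_distrib, Finset.prod_const, Finset.prod_const, Finset.card_range,
    Finset.card_univ, Fintype.card_fin, ← mul_assoc, ← mul_pow, neg_one_mul, neg_neg]

/-! ### Evaluation of the Pochhammer factor and of the polynomials at roots of unity. -/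

theorem ascPochhammer_eval_sub_natCast (p : ℕ) (t : ℂ) :
    (ascPochhammer ℂ p).eval (t - (p + 1)) = ∏ j ∈ Finset.range p, (t - 2 - j) := by
  have h : ∀ (k : ℕ) (s : ℂ), (ascPochhammer ℂ k).eval s = ∏ j ∈ Finset.range k, (s + j) := by
    intro k s
    induction k with
    | zero => simp
    | succ k ih => rw [ascPochhammer_succ_eval, Finset.prod_range_succ, ih]
  rw [h, ← Finset.prod_range_reflect]
  refine Finset.prod_congr rfl fun j hj => ?_
  have hj' : j + 1 ≤ p := Finset.mem_range.1 hj
  rw [show p - 1 - j = p - (j + 1) by omega, Nat.cast_sub hj']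
  push_cast
  ring

/-- Multiplying by (X - 1)² telescopes the arithmetic-geometric sum, making Q and Q' explicit
wherever z^(M+1) = 1. -/
theorem sum_natCast_add_mul_X_pow_mul {R : Type*} [CommRing R] (a : R) (M : ℕ) :
    (∑ l ∈ Finset.range M, C ((l : R) + a) * X ^ l) * (X - 1) ^ 2 =
      C ((M : R) + a - 1) * X ^ (M + 1) - C ((M : R) + a) * X ^ M - C (a - 1) * X + C a := by
  induction M with
  | zero =>
    simp
  | succ M ih =>
    rw [Finset.sum_range_succ, add_mul, ih]
    simp only [Nat.cast_succ, map_add, map_sub, map_one]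
    ring

theorem eval_sum_natCast_add_mul_X_pow {M : ℕ} (a : ℂ) {z : ℂ} (hz : z ^ (M + 1) = 1)
    (hz1 : z ≠ 1) :
    (∑ l ∈ Finset.range M, C ((l : ℂ) + a) * X ^ l).eval z * (z * (z - 1)) =
      (M + a) - (a - 1) * z := by
  have h := congrArg (eval z) (sum_natCast_add_mul_X_pow_mul a M)
  set Q : ℂ[X] := ∑ l ∈ Finset.range M, C ((l : ℂ) + a) * X ^ l
  simp only [eval_mul, eval_sub, eval_add, eval_pow, eval_X, eval_one, eval_C, hz] at h
  rw [pow_succ] at hz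
  apply mul_left_cancel₀ (sub_ne_zero.2 hz1)
  linear_combination z * h - (M + a) * hz

theorem eval_derivative_sum_natCast_add_mul_X_pow {M : ℕ} (a : ℂ) {z : ℂ}
    (hz : z ^ (M + 1) = 1) (hz1 : z ≠ 1) :
    (derivative (∑ l ∈ Finset.range M, C ((l : ℂ) + a) * X ^ l)).eval z *
        (z ^ 2 * (z - 1) ^ 2) =
      (a - 1) * z ^ 2 + ((M - 1) * (M + a) - (M + 1)) * z - M * (M + a) := by
  have hQ := eval_sum_natCast_add_mul_X_pow a hz hz1
  have h := congrArg (fun p => eval z (derivative p)) (sum_natCast_add_mul_X_pow_mul a M)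
  set Q : ℂ[X] := ∑ l ∈ Finset.range M, C ((l : ℂ) + a) * X ^ l
  have hM : (M : ℂ) * z ^ (M - 1) * z = M * z ^ M := by
    rcases M with _ | M
    · simp
    · rw [Nat.add_sub_cancel, pow_succ]
      ring
  simp only [derivative_mul, derivative_pow, derivative_sub, derivative_add, derivative_X,
    derivative_one, derivative_C, eval_mul, eval_sub, eval_add, eval_pow, eval_X,
    eval_one, eval_C, eval_zero, Nat.add_sub_cancel] at h
  norm_num at h
  rw [pow_succ] at hz
  linear_combination z ^ 2 * h - 2 * z * hQ - z * (M + a) * hM +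
    ((M + a - 1) * (M + 1) * z - (M + a) * M) * hz

theorem roots_geom_sum_add (n : ℕ) (hn : 0 < n) :
    (∑ i ∈ Finset.range n, (X : ℂ[X]) ^ i).roots + {1} = (nthRootsFinset n (1 : ℂ)).val := by
  have h : (∑ i ∈ Finset.range n, (X : ℂ[X]) ^ i) * (X - C 1) = X ^ n - C 1 := by
    simpa using geom_sum_mul (X : ℂ[X]) n
  have h0 : (∑ i ∈ Finset.range n, (X : ℂ[X]) ^ i) * (X - C 1) ≠ 0 := by
    rw [h]
    exact X_pow_sub_C_ne_zero hn 1
  have hnd := (Complex.isPrimitiveRoot_exp n hn.ne').nthRoots_one_nodup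
  rw [nthRootsFinset_def, Multiset.toFinset_val, hnd.dedup, nthRoots, ← h, roots_mul h0,
    roots_X_sub_C]

/-- An enumeration of the nontrivial `n`-th roots of unity. -/
theorem exists_equiv_roots_geom_sum (q : ℕ) :
    ∃ e : Fin (q + 1) ≃ (∑ i ∈ Finset.range (q + 2), (X : ℂ[X]) ^ i).roots,
      Function.Injective (fun i => (e i : ℂ)) ∧
      (∀ G : ℂ → ℂ, ∑ i, G (e i : ℂ) + G 1 = ∑ z ∈ nthRootsFinset (q + 2) (1 : ℂ), G z) ∧
      (∀ G : ℂ → ℂ, (∏ i, G (e i : ℂ)) * G 1 = ∏ z ∈ nthRootsFinset (q + 2) (1 : ℂ), G z) := by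
  classical
  have h := roots_geom_sum_add (q + 2) (by omega)
  set s := (∑ i ∈ Finset.range (q + 2), (X : ℂ[X]) ^ i).roots
  have hcard : s.card = q + 1 := by
    have := congrArg Multiset.card h
    rw [Finset.card_val, (Complex.isPrimitiveRoot_exp (q + 2) (by omega)).card_nthRootsFinset] at this
    simpa using this
  have e : Fin (q + 1) ≃ s := Fintype.equivOfCardEq (by simp [hcard])
  have hmap : (Finset.univ : Finset (Fin (q + 1))).val.map (fun i => (e i : ℂ)) = s := by
    conv_rhs => rw [← Multiset.map_univ_coe s]
    rw [← Finset.map_univ_equiv e, Finset.map_val, Multiset.map_map]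
    rfl
  refine ⟨e, ?_, fun G => ?_, fun G => ?_⟩
  · have hnd : s.Nodup :=
      Multiset.nodup_of_le (h ▸ Multiset.le_add_right s {1}) (nthRootsFinset (q + 2) (1 : ℂ)).nodup
    rw [← hmap] at hnd
    intro i k hik
    exact Multiset.inj_on_of_nodup_map hnd i (by simp) k (by simp) hik
  · have : ∑ i, G (e i : ℂ) = (s.map G).sum := by
      conv_rhs => rw [← hmap, Multiset.map_map]
      rfl
    rw [this, Finset.sum, ← h]
    simp
  · have : ∏ i, G (e i : ℂ) = (s.map G).prod := by
      conv_rhs => rw [← hmap, Multiset.map_map]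
      rfl
    rw [this, Finset.prod, ← h]
    simp

/-! ### Assembly of the formula. -/

theorem theorem39 (n m : ℕ) (hn : 2 ≤ n) (hm : 1 ≤ m) (a : ℂ)
    (hcoprime : ∀ z : ℂ, (∑ i ∈ Finset.range n, (X : ℂ[X]) ^ i).eval z = 0 →
      (∑ l ∈ Finset.range (m * n - 1), C ((l : ℂ) + a) * (X : ℂ[X]) ^ l).eval z ≠ 0) :
    ((m : ℂ) * n + a - 1) ^ n - (a - 1) ^ n ≠ 0 ∧
    scottPermanent (∑ i ∈ Finset.range n, (X : ℂ[X]) ^ i)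
        (∑ l ∈ Finset.range (m * n - 1), C ((l : ℂ) + a) * (X : ℂ[X]) ^ l) =
      (-1) ^ (n - 1) *
        ((n : ℂ) * m * (ascPochhammer ℂ (n - 1)).eval ((n : ℂ) * m - n) *
            ((n : ℂ) * m + a - 1) ^ (n - 1)) /
          (((m : ℂ) * n + a - 1) ^ n - (a - 1) ^ n) := by
  classical
  obtain ⟨q, rfl⟩ : ∃ q, n = q + 2 := ⟨n - 2, by omega⟩
  have hequiv := exists_equiv_roots_geom_sum q
  have hMpos : 1 ≤ m * (q + 2) := Nat.mul_pos hm (by omega)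
  obtain ⟨M, hM⟩ : ∃ M, m * (q + 2) = M + 1 := ⟨m * (q + 2) - 1, by omega⟩
  have hMc : (m : ℂ) * ((q + 2 : ℕ) : ℂ) = M + 1 := by exact_mod_cast hM
  rw [hMc, mul_comm ((q + 2 : ℕ) : ℂ) (m : ℂ), hMc, show m * (q + 2) - 1 = M by omega,
    show q + 2 - 1 = q + 1 by omega, show (M : ℂ) + 1 + a - 1 = M + a by ring]
  rw [show m * (q + 2) - 1 = M by omega] at hcoprime
  set P : ℂ[X] := ∑ i ∈ Finset.range (q + 2), (X : ℂ[X]) ^ i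
  set Q : ℂ[X] := ∑ l ∈ Finset.range M, C ((l : ℂ) + a) * (X : ℂ[X]) ^ l with hQ
  obtain ⟨e, hinj, hsum, hprod⟩ := hequiv
  have hPeval : ∀ z, P.eval z = ∑ i ∈ Finset.range (q + 2), z ^ i := fun z => eval_geom_sum
  have hroot : ∀ i, P.eval (e i : ℂ) = 0 := fun i => (mem_roots'.1 (Multiset.coe_mem)).2
  have hpow : ∀ i, (e i : ℂ) ^ (q + 2) = 1 := by
    intro i
    have h := hroot i
    rw [hPeval] at h
    have h' := geom_sum_mul (e i : ℂ) (q + 2)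
    rw [h, zero_mul] at h'
    exact (sub_eq_zero.1 h'.symm)
  have hx1 : ∀ i, (e i : ℂ) ≠ 1 := by
    intro i h
    have h' := hroot i
    rw [h, hPeval] at h'
    simp only [one_pow, Finset.sum_const, Finset.card_range, nsmul_eq_mul, mul_one] at h'
    exact absurd (Nat.cast_eq_zero.1 h') (by omega)
  have hpowM : ∀ i, (e i : ℂ) ^ (M + 1) = 1 := by
    intro i
    rw [← hM, mul_comm, pow_mul, hpow, one_pow]
  have hQx : ∀ i, Q.eval (e i : ℂ) ≠ 0 := fun i => hcoprime _ (hroot i)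
  have hQeval := fun i => eval_sum_natCast_add_mul_X_pow a (hpowM i) (hx1 i)
  have hx0 : ∀ i, (e i : ℂ) ≠ 0 := by
    intro i h
    have := hpow i
    simp [h] at this
  have hbc : ∀ i, ((M : ℂ) + a) - (a - 1) * (e i : ℂ) ≠ 0 := by
    intro i
    rw [← hQeval i]
    exact mul_ne_zero (hQx i) (mul_ne_zero (hx0 i) (sub_ne_zero.2 (hx1 i)))
  have hM0 : (M : ℂ) + 1 ≠ 0 := Nat.cast_add_one_ne_zero M
  have hζ := Complex.isPrimitiveRoot_exp (q + 2) (by omega)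
  -- The product of b - cz over all n-th roots of unity is b^n - c^n; the factor M + 1 = b - c is
  -- the one at z = 1.
  have hden : (∏ i, (((M : ℂ) + a) - (a - 1) * (e i : ℂ))) * (M + 1) =
      ((M : ℂ) + a) ^ (q + 2) - (a - 1) ^ (q + 2) := by
    rw [hζ.pow_sub_pow_eq_prod_sub_mul _ _ (by omega), ← hprod]
    congr 1
    · exact Finset.prod_congr rfl fun i _ => by ring
    · ring
  -- The same factorization, at the pair (0, -1), yields the product of the roots.
  have hprodx : ∏ i, (e i : ℂ) = (-1) ^ (q + 1) := by
    have h1 := hζ.pow_sub_pow_eq_prod_sub_mul 0 (-1) (by omega)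
    rw [← hprod] at h1
    simp only [mul_neg, mul_one, zero_sub, neg_neg] at h1
    rw [← h1, pow_succ (-1 : ℂ) (q + 1)]
    simp
  have hden0 : ((M : ℂ) + a) ^ (q + 2) - (a - 1) ^ (q + 2) ≠ 0 := by
    rw [← hden]
    exact mul_ne_zero (Finset.prod_ne_zero_iff.2 fun i _ => hbc i) hM0
  refine ⟨hden0, ?_⟩
  -- The logarithmic derivative Q'/Q at x_i, from the explicit values of Q and Q' there.
  have hL : ∀ i, (∑ j : Q.roots, 1 / ((e i : ℂ) - (j : ℂ))) *
      ((e i : ℂ) * ((M + a) - (a - 1) * (e i : ℂ)) * ((e i : ℂ) - 1)) =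
      (a - 1) * (e i : ℂ) ^ 2 + (((M + a) - (a - 1) - 2) * (M + a) - ((M + a) - (a - 1))) * (e i : ℂ)
        - ((M + a) - (a - 1) - 1) * (M + a) := by
    intro i
    have h1 : Q.derivative.eval (e i : ℂ) =
        Q.eval (e i : ℂ) * ∑ j : Q.roots, 1 / ((e i : ℂ) - (j : ℂ)) := by
      rw [(IsAlgClosed.splits Q).eval_derivative_eq_eval_mul_sum (hQx i),
        ← Multiset.map_univ_comp_coe]
      rfl
    have h2 := eval_derivative_sum_natCast_add_mul_X_pow a (hpowM i) (hx1 i)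
    rw [← hQ, h1] at h2
    rw [← hQeval i, ← hQ]
    linear_combination h2
  have hper : scottPermanent P Q =
      (borchardtMatrix (fun i => (e i : ℂ)) fun j : Q.roots => (j : ℂ)).det := by
    rw [scottPermanent, ← rectPermanent_reindex e, ← rectPermanent_cauchy _ _ hinj]
    · rfl
    · intro i j h
      refine hQx i ?_
      rw [h]
      exact (mem_roots'.1 Multiset.coe_mem).2
  have hdet := det_borchardtMatrix_nthRoots _ hinj hsum hpow hx1 (fun j : Q.roots => (j : ℂ))
    ((M : ℂ) + a) (a - 1) hbc hL
  have hpoch := ascPochhammer_eval_sub_natCast (q + 1) ((M : ℂ) + 1)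
  rw [show (M : ℂ) + a - (a - 1) - 2 = M + 1 - 2 by ring, ← hpoch, ← hper,
    Finset.prod_mul_distrib, hprodx] at hdet
  rw [eq_div_iff hden0, ← hden]
  have hsign : ((-1 : ℂ) ^ (q + 1)) * (-1) ^ (q + 1) = 1 := by
    rw [← mul_pow]
    simp
  push_cast at hdet ⊢
  rw [show (q : ℂ) + 2 = q + 1 + 1 by ring]
  linear_combination (-1) ^ (q + 1) * (M + 1) * hdet - scottPermanent P Q *
    (∏ i, (((M : ℂ) + a) - (a - 1) * (e i : ℂ))) * (M + 1) * hsign
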